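/- Let $\mathbb N=\{1,2,3,\dots\}$. For every countable limit ordinal $\beta$ fix a sequence $(\beta_n)_{n\in\mathbb N}$ of ordinals $<\beta$ that increases to $\beta$. The Schreier families $\mathrm S_\alpha$ $(\alpha<\omega_1)$ of finite subsets of $\mathbb N$ are defined recursively by $\mathrm S_0=\{\{n\}:n\in\mathbb N\}$; $\mathrm S_{\alpha+1}=\{\bigcup_{j=1}^nE_j : n\in\mathbb N,\ E_1,\dots,E_n\in \mathrm S_\alpha,\ n\le \min E_1,\ \max E_j<\min E_{j+1}\text{ for }1\le j<n\}$; and, for a limit ordinal $\beta$, $\mathrm S_\beta=\{A : A\in \mathrm S_{\beta_n}\text{ and } n\le\min A\text{ for some }n\in\mathbb N\}$. Let $\mathrm S_\alpha(\mathbb Z)=\{\sum_{i\in G}c_ie_i : G\in \mathrm S_\alpha,\ c_i\in\mathbb Z\}\subset \mathrm c_0$, where $(e_i)$ is the unit vector basis of the real Banach space $\mathrm c_0$, with the metric $d_\infty(x,y)=\|x-y\|_\infty$. A metric space $X$ coarsely embeds into a metric space $Y$ if there are a map $f:X\to Y$ and non-decreasing functions $\rho,\omega:[0,\infty)\to[0,\infty)$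 with $\lim_{t\to\infty}\rho(t)=\infty$ and $\rho(d_X(x,y))\le d_Y(f(x),f(y))\le\omega(d_X(x,y))$ for all $x,y\in X$. Corollary. Let $(M,d)$ be a separable metric space. If for every $\alpha<\omega_1$ the metric space $(\mathrm S_\alpha(\mathbb Z),d_\infty)$ coarsely embeds into $M$, then $\mathrm c_0$ coarsely embeds into $M^4$ equipped with the metric $\max_{1\le k\le 4}d(x_k,y_k)$. (No set-theoretic axioms beyond ZFC are assumed.) -/

import Mathlib

open Filter Topology
open scoped NNReal Ordinal ZeroAtInfty

/-- `X` coarsely embeds into `Y`: there are non-decreasing `ρ, σ : [0,∞) → [0,∞)` with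
`ρ(t) → ∞` as `t → ∞`, and a map `f : X → Y` with
`ρ (d(x,y)) ≤ d(f x, f y) ≤ σ (d(x,y))` for all `x, y`. -/
def CoarselyEmbeds (X Y : Type*) [MetricSpace X] [MetricSpace Y] : Prop :=
  ∃ ρ σ : ℝ≥0 → ℝ≥0, Monotone ρ ∧ Monotone σ ∧ Tendsto ρ atTop atTop ∧
    ∃ f : X → Y, ∀ x y : X,
      ρ (nndist x y) ≤ nndist (f x) (f y) ∧ nndist (f x) (f y) ≤ σ (nndist x y)

/-- `a` assigns to every countable limit ordinal `β` a sequence of ordinals below `β` which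
increases to `β`. (The values at other ordinals are irrelevant, and so is the term of index `0`.) -/
def IsLimitChoice (a : Ordinal.{0} → ℕ → Ordinal.{0}) : Prop :=
  ∀ β : Ordinal.{0}, β < ω₁ → Order.IsSuccLimit β →
    Monotone (a β) ∧ (∀ n, a β n < β) ∧ IsLUB (Set.range (a β)) β

/-- `Schreier a α A` says that `A` belongs to the Schreier family `S_α` of finite subsets of
`{1, 2, 3, …}`, where `a β` is the sequence used at the limit ordinal `β`. -/
inductive Schreier (a : Ordinal.{0} → ℕ → Ordinal.{0}) : Ordinal.{0} → Finset ℕ → Prop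
  /-- `S_0` consists of the singletons. -/
  | zero (n : ℕ) (hn : 1 ≤ n) : Schreier a 0 {n}
  /-- `S_{α+1}` consists of the unions of `E_1, …, E_n ∈ S_α` with `n ≤ E_1 < ⋯ < E_n`. -/
  | succ (α : Ordinal.{0}) (n : ℕ) (hn : 1 ≤ n) (E : Fin n → Finset ℕ)
      (hE : ∀ i, Schreier a α (E i))
      (hmin : ∀ i, ∀ x ∈ E i, n ≤ x)
      (hlt : ∀ i j, i < j → ∀ x ∈ E i, ∀ y ∈ E j, x < y) :
      Schreier a (α + 1) (Finset.univ.biUnion E)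
  /-- `S_β`, for a limit `β`, consists of the `A` with `n ≤ A` and `A ∈ S_{a β n}`
  for some `n`. -/
  | limit (β : Ordinal.{0}) (hβ : Order.IsSuccLimit β) (n : ℕ) (hn : 1 ≤ n) (A : Finset ℕ)
      (hmin : ∀ x ∈ A, n ≤ x) (hA : Schreier a (a β n) A) : Schreier a β A

/-! The three recursion equations for the Schreier families. -/

theorem schreier_zero_iff (a : Ordinal.{0} → ℕ → Ordinal.{0}) (A : Finset ℕ) :
    Schreier a 0 A ↔ ∃ n : ℕ, 1 ≤ n ∧ A = {n} := by
  constructor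
  · intro h
    generalize hα : (0 : Ordinal.{0}) = α at h
    cases h with
    | zero n hn => exact ⟨n, hn, rfl⟩
    | succ α n hn E hE hmin hlt => exact absurd hα.symm (by simp)
    | limit _ hβ => exact absurd (hα ▸ hβ) (by simp)
  · rintro ⟨n, hn, rfl⟩
    exact .zero n hn

theorem schreier_succ_iff (a : Ordinal.{0} → ℕ → Ordinal.{0}) (α : Ordinal.{0})
    (A : Finset ℕ) :
    Schreier a (α + 1) A ↔ ∃ n : ℕ, 1 ≤ n ∧ ∃ E : Fin n → Finset ℕ,
      (∀ i, Schreier a α (E i)) ∧ (∀ i, ∀ x ∈ E i, n ≤ x) ∧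
      (∀ i j, i < j → ∀ x ∈ E i, ∀ y ∈ E j, x < y) ∧ A = Finset.univ.biUnion E := by
  constructor
  · intro h
    generalize hα : α + 1 = γ at h
    cases h with
    | zero n hn => exact absurd hα (by simp)
    | succ α' n hn E hE hmin hlt =>
      obtain rfl : α = α' := by simpa using hα
      exact ⟨n, hn, E, hE, hmin, hlt, rfl⟩
    | limit _ hβ =>
      subst hα
      exact absurd hβ (by simp [← Order.succ_eq_add_one])
  · rintro ⟨n, hn, E, hE, hmin, hlt, rfl⟩
    exact .succ α n hn E hE hmin hlt

theorem schreier_limit_iff (a : Ordinal.{0} → ℕ → Ordinal.{0}) (β : Ordinal.{0})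
    (hβ : Order.IsSuccLimit β) (A : Finset ℕ) :
    Schreier a β A ↔ ∃ n : ℕ, 1 ≤ n ∧ (∀ x ∈ A, n ≤ x) ∧ Schreier a (a β n) A := by
  constructor
  · intro h
    cases h with
    | zero n hn => exact absurd hβ (by simp)
    | succ α n hn E hE hmin hlt => exact absurd hβ (by simp [← Order.succ_eq_add_one])
    | limit _ _ n hn _ hmin hA => exact ⟨n, hn, hmin, hA⟩
  · rintro ⟨n, hn, hmin, hA⟩
    exact .limit β hβ n hn A hmin hA

/-- The set of all `∑_{i ∈ G} c_i e_i` with `G ∈ 𝒢` and all `c_i ∈ 𝔼`, as a subset of the real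
Banach space `c₀`, which is `C₀(ℕ, ℝ)` with the supremum norm. As a type it carries the metric
`d_∞` inherited from `c₀`. -/
def supportedIn (𝒢 : Set (Finset ℕ)) (𝔼 : Set ℝ) : Set C₀(ℕ, ℝ) :=
  {x | ∃ G ∈ 𝒢, (∀ i ∈ G, x i ∈ 𝔼) ∧ ∀ i ∉ G, x i = 0}

/-- The metric space `(S_α(ℤ), d_∞)`. -/
abbrev schreierSpace (a : Ordinal.{0} → ℕ → Ordinal.{0}) (α : Ordinal.{0}) :
    Set C₀(ℕ, ℝ) :=
  supportedIn {A | Schreier a α A} (Set.range ((↑) : ℤ → ℝ))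

/-!
A map into a separable space may be moved, at bounded cost, into a fixed countable dense set, and
the control functions of a coarse embedding may be encoded by sequences of natural numbers. Thus a
coarse embedding of a space of integer vectors is described by a sequence of natural numbers.
Suppose that `f_α` is a coarse embedding of `S_α(ℤ)` for every `α < ω₁`. Each injective sequence
`u = (u_0, …, u_{n-1})` with values in a member of `S_α` moves the integer vectors supported in
`{0, …, n-1}` isometrically into `S_α(ℤ)`; colour `u` by the `n`-th term of the description of the
map that it induces on them. The tree of these sequences has rank at least `α`. Hence the tree of
all finite words of colours has rank at least `ω₁`; being a tree on a countable set, it has an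
infinite branch. Such a branch describes a coarse embedding of all finitely supported integer
vectors, which form a net in `c₀`.
-/

/-! ### Control functions with values in `ℕ` -/

/-- The inequalities of a coarse embedding for one pair of points at distance `d` whose images are
at distance `d'`. The functions `σ` and `ρ` are replaced by sequences: `S k` bounds the
distances of images of points at distance at most `k`, and points at distance at least `R m` have
images at distance at least `m`. -/
structure Controlled (S R : ℕ → ℕ) (d d' : ℝ) : Prop where
  upper (k : ℕ) : d ≤ k → d' ≤ S k
  lower (m : ℕ) : R m ≤ d → m ≤ d'

namespace Controlled

theorem of_dist_le {S R : ℕ → ℕ} {d₁ d₁' d₂ d₂' : ℝ} {c c' : ℕ} (h : Controlled S R d₁ d₁')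
    (hd : dist d₁ d₂ ≤ c) (hd' : dist d₁' d₂' ≤ c') :
    Controlled (fun k => S (k + c) + c') (fun m => R (m + c') + c) d₂ d₂' := by
  rw [Real.dist_eq, abs_le] at hd hd'
  refine ⟨fun k hk => ?_, fun m hm => ?_⟩
  · have := h.upper (k + c) (by push_cast; linarith)
    push_cast
    linarith
  · push_cast at hm
    have := h.lower (m + c') (by linarith)
    push_cast at this
    linarith

theorem of_forall_eq_lt {S R : ℕ → ℕ} {d d' : ℝ}
    (h : ∀ n, ∃ S' R', (∀ k < n, S' k = S k ∧ R' k = R k) ∧ Controlled S' R' d d') :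
    Controlled S R d d' := by
  refine ⟨fun k hk => ?_, fun m hm => ?_⟩
  · obtain ⟨S', R', heq, hctrl⟩ := h (k + 1)
    exact (heq k k.lt_succ_self).1 ▸ hctrl.upper k hk
  · obtain ⟨S', R', heq, hctrl⟩ := h (m + 1)
    exact hctrl.lower m ((heq m m.lt_succ_self).2 ▸ hm)

end Controlled

namespace CoarselyEmbeds

variable {X Y : Type*} [MetricSpace X] [MetricSpace Y]

theorem exists_controlled (h : CoarselyEmbeds X Y) :
    ∃ (S R : ℕ → ℕ) (f : X → Y), ∀ x y, Controlled S R (dist x y) (dist (f x) (f y)) := by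
  obtain ⟨ρ, σ, -, hσ, hρ, f, hf⟩ := h
  have hR (m : ℕ) : ∃ r : ℕ, ∀ t : ℝ≥0, r ≤ t → m ≤ ρ t := by
    obtain ⟨t₀, ht₀⟩ := eventually_atTop.1 (tendsto_atTop.1 hρ m)
    obtain ⟨r, hr⟩ := exists_nat_ge t₀
    exact ⟨r, fun t ht => ht₀ t (hr.trans ht)⟩
  choose R hR using hR
  refine ⟨fun k => ⌈σ k⌉₊, R, f, fun x y => ⟨fun k hk => ?_, fun m hm => ?_⟩⟩
  · have hk : nndist x y ≤ k := by exact_mod_cast hk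
    exact_mod_cast (hf x y).2.trans ((hσ hk).trans (Nat.le_ceil _))
  · have hm : (R m : ℝ≥0) ≤ nndist x y := by exact_mod_cast hm
    exact_mod_cast (hR m _ hm).trans (hf x y).1

theorem of_controlled {S R : ℕ → ℕ} (f : X → Y)
    (hf : ∀ x y, Controlled S R (dist x y) (dist (f x) (f y))) : CoarselyEmbeds X Y := by
  classical
  let ρ (t : ℝ≥0) : ℕ := Nat.findGreatest (fun m => (R m : ℝ≥0) ≤ t) ⌊t⌋₊
  have hρ : Monotone ρ := fun s t hst =>
    Nat.findGreatest_mono (fun m hm => hm.trans hst) (Nat.floor_mono hst)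
  refine ⟨fun t => ρ t, fun t => partialSups S ⌈t⌉₊, Nat.mono_cast.comp hρ,
    Nat.mono_cast.comp ((partialSups S).monotone.comp Nat.ceil_mono),
    tendsto_natCast_atTop_atTop.comp (tendsto_atTop.2 fun m => ?_), f, fun x y => ⟨?_, ?_⟩⟩
  · filter_upwards [eventually_ge_atTop (m : ℝ≥0), eventually_ge_atTop (R m : ℝ≥0)] with t hm hRm
    exact Nat.le_findGreatest (Nat.le_floor hm) hRm
  · rcases eq_or_ne (ρ (nndist x y)) 0 with h0 | h0
    · simp [h0]
    · have hspec : (R (ρ (nndist x y)) : ℝ≥0) ≤ nndist x y := Nat.findGreatest_of_ne_zero rfl h0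
      exact_mod_cast (hf x y).lower _ (by exact_mod_cast hspec)
  · have hk : dist x y ≤ ⌈nndist x y⌉₊ := by exact_mod_cast Nat.le_ceil (nndist x y)
    have hS : S ⌈nndist x y⌉₊ ≤ partialSups S ⌈nndist x y⌉₊ := le_partialSups S _
    exact_mod_cast ((hf x y).upper _ hk).trans (Nat.cast_le.2 hS)

theorem nonempty [Nonempty X] (h : CoarselyEmbeds X Y) : Nonempty Y := by
  obtain ⟨-, -, -, -, -, f, -⟩ := h
  exact Nonempty.map f ‹_›

theorem pi_const {ι : Type*} [Fintype ι] [Nonempty ι] (h : CoarselyEmbeds X Y) :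
    CoarselyEmbeds X (ι → Y) := by
  obtain ⟨ρ, σ, hρ, hσ, hρ_tendsto, f, hf⟩ := h
  exact ⟨ρ, σ, hρ, hσ, hρ_tendsto, fun x _ => f x, fun x y => by
    simpa only [nndist_pi_const] using hf x y⟩

end CoarselyEmbeds

theorem CoarselyEmbeds.exists_controlled_denseSeq {X Y : Type*} [MetricSpace X] [MetricSpace Y]
    [TopologicalSpace.SeparableSpace Y] [Nonempty Y] {s : Set X} (h : CoarselyEmbeds s Y) :
    ∃ (S R : ℕ → ℕ) (Φ : X → ℕ), ∀ x ∈ s, ∀ y ∈ s, Controlled S R (dist x y)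
      (dist (TopologicalSpace.denseSeq Y (Φ x)) (TopologicalSpace.denseSeq Y (Φ y))) := by
  obtain ⟨S, R, f, hf⟩ := h.exists_controlled
  have happrox (x : X) :
      ∃ i, ∀ hx : x ∈ s, dist (f ⟨x, hx⟩) (TopologicalSpace.denseSeq Y i) < 1 := by
    by_cases hx : x ∈ s
    · obtain ⟨i, hi⟩ :=
        (TopologicalSpace.denseRange_denseSeq Y).exists_dist_lt (f ⟨x, hx⟩) one_pos
      exact ⟨i, fun _ => hi⟩
    · exact ⟨0, fun h => absurd h hx⟩
  choose Φ hΦ using happrox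
  refine ⟨_, _, Φ, fun x hx y hy => (hf ⟨x, hx⟩ ⟨y, hy⟩).of_dist_le (c := 0) (c' := 2) ?_ ?_⟩
  · simp [Subtype.dist_eq]
  · refine (dist_dist_dist_le _ _ _ _).trans ?_
    push_cast
    linarith [hΦ x hx, hΦ y hy]

theorem CoarselyEmbeds.of_controlled_net {X Y Z : Type*} [MetricSpace X] [MetricSpace Y]
    {S R : ℕ → ℕ} (g : Z → X) (F : Z → Y)
    (hF : ∀ x y, Controlled S R (dist (g x) (g y)) (dist (F x) (F y)))
    {c : ℕ} (hg : ∀ x, ∃ z, dist x (g z) ≤ c) : CoarselyEmbeds X Y := by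
  choose z hz using hg
  refine .of_controlled (fun x => F (z x)) fun x y =>
    (hF (z x) (z y)).of_dist_le (c := 2 * c) (c' := 0) ?_ (by simp)
  refine (dist_dist_dist_le _ _ _ _).trans ?_
  rw [dist_comm _ x, dist_comm _ y]
  push_cast
  linarith [hz x, hz y]

/-! ### Integer vectors in `c₀` -/

theorem norm_c₀_le_iff {f : C₀(ℕ, ℝ)} {r : ℝ} (hr : 0 ≤ r) : ‖f‖ ≤ r ↔ ∀ i, |f i| ≤ r := by
  rw [← ZeroAtInftyContinuousMap.norm_toBCF_eq_norm, BoundedContinuousFunction.norm_le hr]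
  rfl

/-- The embedding into `c₀` of the group of finitely supported integer vectors. -/
def toC₀ : (ℕ →₀ ℤ) →+ C₀(ℕ, ℝ) where
  toFun x :=
    { toFun i := x i
      continuous_toFun := continuous_of_discreteTopology
      zero_at_infty' := by
        refine tendsto_const_nhds.congr' ?_
        rw [cocompact_eq_cofinite]
        filter_upwards [x.support.finite_toSet.compl_mem_cofinite] with i hi
        simp [Finsupp.notMem_support_iff.1 hi] }
  map_zero' := by ext; simp
  map_add' x y := by ext; simp

@[simp] theorem toC₀_apply (x : ℕ →₀ ℤ) (i : ℕ) : toC₀ x i = x i := rfl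

theorem norm_toC₀_mapDomain {u : ℕ → ℕ} {x : ℕ →₀ ℤ} (hu : Set.InjOn u x.support) :
    ‖toC₀ (x.mapDomain u)‖ = ‖toC₀ x‖ := by
  have hux {i : ℕ} (hi : i ∈ x.support) : toC₀ (x.mapDomain u) (u i) = toC₀ x i := by
    simp [Finsupp.mapDomain_apply' _ x subset_rfl hu hi]
  refine le_antisymm ((norm_c₀_le_iff (norm_nonneg _)).2 fun j => ?_)
    ((norm_c₀_le_iff (norm_nonneg _)).2 fun i => ?_)
  · by_cases hj : j ∈ (x.mapDomain u).support
    · obtain ⟨i, hi, rfl⟩ := Finset.mem_image.1 (Finsupp.mapDomain_support hj)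
      rw [hux hi]
      exact (norm_c₀_le_iff (norm_nonneg _)).1 le_rfl i
    · simp [Finsupp.notMem_support_iff.1 hj]
  · by_cases hi : i ∈ x.support
    · rw [← hux hi]
      exact (norm_c₀_le_iff (norm_nonneg _)).1 le_rfl (u i)
    · simp [Finsupp.notMem_support_iff.1 hi]

theorem dist_toC₀_mapDomain {u : ℕ → ℕ} {s : Finset ℕ} (hu : Set.InjOn u s) {x y : ℕ →₀ ℤ}
    (hx : x.support ⊆ s) (hy : y.support ⊆ s) :
    dist (toC₀ (x.mapDomain u)) (toC₀ (y.mapDomain u)) = dist (toC₀ x) (toC₀ y) := by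
  rw [dist_eq_norm, dist_eq_norm, ← map_sub, ← map_sub, ← Finsupp.mapDomain_sub,
    norm_toC₀_mapDomain]
  exact hu.mono (Finset.coe_subset.2 (Finsupp.support_sub.trans (Finset.union_subset hx hy)))

theorem toC₀_mapDomain_mem_supportedIn {𝒢 : Set (Finset ℕ)} {u : ℕ → ℕ} {G : Finset ℕ}
    (hG : G ∈ 𝒢) {x : ℕ →₀ ℤ} (hu : ∀ i ∈ x.support, u i ∈ G) :
    toC₀ (x.mapDomain u) ∈ supportedIn 𝒢 (Set.range ((↑) : ℤ → ℝ)) := by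
  refine ⟨G, hG, fun i _ => ⟨_, rfl⟩, fun i hi => ?_⟩
  have hi' : i ∉ (x.mapDomain u).support := fun h => by
    obtain ⟨j, hj, rfl⟩ := Finset.mem_image.1 (Finsupp.mapDomain_support h)
    exact hi (hu j hj)
  simp [Finsupp.notMem_support_iff.1 hi']

theorem exists_dist_toC₀_le_half (f : C₀(ℕ, ℝ)) : ∃ x : ℕ →₀ ℤ, dist f (toC₀ x) ≤ 1 / 2 := by
  have hfin : {i | round (f i) ≠ 0}.Finite := by
    have hf : Tendsto f cofinite (𝓝 0) := cocompact_eq_cofinite ℕ ▸ f.zero_at_infty'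
    have hev : ∀ᶠ i in cofinite, |f i| < 1 / 2 := by
      simpa using hf.eventually (Metric.ball_mem_nhds 0 one_half_pos)
    refine eventually_cofinite.1 (hev.mono fun i hi => ?_)
    rw [abs_lt] at hi
    exact round_eq_zero_iff.2 ⟨hi.1.le, hi.2⟩
  refine ⟨.ofSupportFinite (fun i => round (f i)) hfin, ?_⟩
  rw [dist_eq_norm, norm_c₀_le_iff one_half_pos.le]
  exact fun i => abs_sub_round (f i)

/-! ### Ranks of trees -/

section Trees

open Descriptive

universe u v

variable {A C : Type u}

/-- `RankGE T β` says that the root of the tree `T` has rank at least `β`. It is expressed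
through all labellings of the nodes by ordinals which decrease strictly along `T`: the rank function
of a well-founded tree is the smallest of them, and an ill-founded tree has none. -/
def RankGE (T : tree A) (β : Ordinal.{u}) : Prop :=
  ∀ φ : List A → Ordinal.{u}, (∀ x a, x ++ [a] ∈ T → φ (x ++ [a]) < φ x) → β ≤ φ []

theorem RankGE.map {T : tree A} {T' : tree C} {β : Ordinal.{u}} (h : RankGE T β)
    (f : List A → List C) (hnil : f [] = [])
    (hf : ∀ x a, x ++ [a] ∈ T → f (x ++ [a]) ∈ T' ∧ ∃ c, f (x ++ [a]) = f x ++ [c]) :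
    RankGE T' β := fun φ hφ => by
  rw [← hnil]
  refine h (φ ∘ f) fun x a hx => ?_
  obtain ⟨hmem, c, hc⟩ := hf x a hx
  simpa only [Function.comp_apply, hc] using hφ _ _ (hc ▸ hmem)

/-- The relation between a node of a tree and its immediate successors, with the successor on the
left so that well-foundedness means the absence of infinite branches. -/
def IsChild (T : tree A) (y x : T) : Prop := ∃ a, y.1 = x.1 ++ [a]

theorem exists_branch_of_not_acc {T : tree A} (hnil : [] ∈ T) (h : ¬Acc (IsChild T) ⟨[], hnil⟩) :
    ∃ w : ℕ → A, ∀ n, (List.range n).map w ∈ T := by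
  obtain ⟨f, hf0, hf⟩ := not_acc_iff_exists_descending_chain.1 h
  choose w hw using hf
  have hfw (n : ℕ) : (f n : List A) = (List.range n).map w := by
    induction n with
    | zero => simp [hf0]
    | succ n ih => rw [hw, ih, List.range_succ, List.map_append, List.map_singleton]
  exact ⟨w, fun n => hfw n ▸ (f n).2⟩

theorem wellFounded_isChild {T : tree A} (hnil : [] ∈ T) (h : Acc (IsChild T) ⟨[], hnil⟩) :
    WellFounded (IsChild T) := by
  refine ⟨fun ⟨x, hx⟩ => ?_⟩
  induction x using List.reverseRecOn with
  | nil => exact h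
  | append_singleton x a ih => exact (ih (Tree.mem_of_append hx)).inv ⟨a, rfl⟩

theorem acc_rank_lt_omega_one {α : Type u} [Countable α] {r : α → α → Prop} {x : α}
    (h : Acc r x) : h.rank < ω₁ := by
  induction h with
  | intro x hacc ih =>
    rw [Acc.rank_eq]
    exact Ordinal.iSup_lt_omega_one fun y =>
      (Cardinal.isSuccLimit_omega 1).succ_lt (ih y y.2)

theorem RankGE.exists_branch [Countable A] {T : tree A} (h : RankGE T ω₁) :
    ∃ w : ℕ → A, ∀ n, (List.range n).map w ∈ T := by
  classical
  by_cases hnil : [] ∈ T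
  · refine exists_branch_of_not_acc hnil fun hacc => ?_
    have hwf := wellFounded_isChild hnil hacc
    let φ (x : List A) : Ordinal.{u} := if hx : x ∈ T then (hwf.apply ⟨x, hx⟩).rank else 0
    have hφ (x : List A) (a : A) (hxa : x ++ [a] ∈ T) : φ (x ++ [a]) < φ x := by
      have hx : x ∈ T := Tree.mem_of_append hxa
      simp only [φ, dif_pos hxa, dif_pos hx]
      exact Acc.rank_lt_of_rel _ ⟨a, rfl⟩
    have hroot : φ [] < ω₁ := by
      simp only [φ, dif_pos hnil]
      exact acc_rank_lt_omega_one _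
    exact (h φ hφ).not_gt hroot
  · exact absurd (h (fun _ => 0) fun x a hxa => absurd (Tree.mem_of_append (x := []) hxa) hnil)
      (Ordinal.omega_pos 1).not_ge

/-- The sequence of the colours of all proper prefixes of a finite sequence, for a colouring `c` of
the finite sequences. -/
def colourWord (c : List A → C) (x : List A) : List C :=
  (List.range x.length).map fun k => c (x.take k)

theorem colourWord_append_singleton (c : List A → C) (x : List A) (a : A) :
    colourWord c (x ++ [a]) = colourWord c x ++ [c x] := by
  simp only [colourWord, List.length_append, List.length_singleton, List.range_succ,
    List.map_append, List.map_singleton, List.take_left']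
  congr 1
  refine List.map_congr_left fun k hk => ?_
  rw [List.take_append_of_le_length (List.mem_range.1 hk).le]

/-- The tree of all colour words of the nodes of the trees `T i`, with respect to the
colourings `c i`. -/
def colourTree {ι : Type v} (T : ι → tree A) (c : ι → List A → C) : tree C :=
  ⟨{l | ∃ i, ∃ x ∈ T i, colourWord (c i) x = l}, by
    rintro l b ⟨i, x, hx, hxl⟩
    rcases x.eq_nil_or_concat' with rfl | ⟨x, a, rfl⟩
    · simp [colourWord] at hxl
    · rw [colourWord_append_singleton] at hxl
      exact ⟨i, x, Tree.mem_of_append hx, (List.append_inj' hxl rfl).1⟩⟩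

theorem exists_colour_branch [Countable C] {ι : Type v} {T : ι → tree A}
    (hT : ∀ β < ω₁, ∃ i, RankGE (T i) β) (c : ι → List A → C) :
    ∃ w : ℕ → C, ∀ n, ∃ i, ∃ x ∈ T i, x.length = n ∧ ∀ k < n, c i (x.take k) = w k := by
  have hrank : RankGE (colourTree T c) ω₁ := fun φ hφ =>
    (Cardinal.isSuccLimit_omega 1).le_iff_forall_le.2 fun β hβ => by
      obtain ⟨i, hi⟩ := hT β hβ
      have hcolour : RankGE (colourTree T c) β := hi.map (colourWord (c i)) rfl
        fun x a hx => ⟨⟨i, _, hx, rfl⟩, _, colourWord_append_singleton _ _ _⟩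
      exact hcolour φ hφ
  obtain ⟨w, hw⟩ := hrank.exists_branch
  refine ⟨w, fun n => ?_⟩
  obtain ⟨i, x, hx, hxw⟩ := hw n
  obtain rfl : x.length = n := by simpa [colourWord] using congrArg List.length hxw
  exact ⟨i, x, hx, rfl, fun k hk => List.map_inj_left.1 hxw k (List.mem_range.2 hk)⟩

/-- The tree of the injective finite sequences with values in a common member of `𝒢`. -/
def injectiveTuples (𝒢 : Set (Finset A)) : tree A :=
  ⟨{x | x.Nodup ∧ ∃ G ∈ 𝒢, ∀ a ∈ x, a ∈ G}, by
    rintro x a ⟨hx, G, hG, hxG⟩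
    exact ⟨hx.of_append_left, G, hG, fun b hb => hxG b (List.mem_append_left _ hb)⟩⟩

theorem mem_injectiveTuples {𝒢 : Set (Finset A)} {x : List A} :
    x ∈ injectiveTuples 𝒢 ↔ x.Nodup ∧ ∃ G ∈ 𝒢, ∀ a ∈ x, a ∈ G :=
  Iff.rfl

end Trees

/-! ### Ranks of Schreier families -/

section SchreierRank

variable {a : Ordinal.{0} → ℕ → Ordinal.{0}}

theorem schreier_singleton (ha : IsLimitChoice a) {k : ℕ} (hk : 1 ≤ k) {α : Ordinal.{0}}
    (hα : α < ω₁) : Schreier a α {k} := by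
  induction α using Ordinal.limitRecOn with
  | zero => exact .zero k hk
  | add_one α ih =>
    exact (schreier_succ_iff a α _).2 ⟨1, le_rfl, fun _ => {k},
      fun _ => ih ((lt_add_one α).trans hα), by simpa using hk,
      fun i j hij => absurd hij (by simp [Subsingleton.elim i j]), by simp⟩
  | limit β hβ ih =>
    have hlt : a β 1 < β := (ha β hα hβ).2.1 1
    exact .limit β hβ 1 le_rfl _ (by simpa using hk) (ih _ hlt (hlt.trans hα))

theorem schreier_insert (ha : IsLimitChoice a) {k : ℕ} (hk : 2 ≤ k) {α : Ordinal.{0}} (hα : α < ω₁)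
    {A : Finset ℕ} (hA : Schreier a α A) (hkA : ∀ x ∈ A, k < x) :
    Schreier a (α + 1) (insert k A) := by
  refine (schreier_succ_iff a α _).2 ⟨2, one_le_two, ![{k}, A], ?_, ?_, ?_, ?_⟩
  · simpa [Fin.forall_fin_two] using ⟨schreier_singleton ha (one_le_two.trans hk) hα, hA⟩
  · simpa [Fin.forall_fin_two] using ⟨hk, fun x hx => hk.trans (hkA x hx).le⟩
  · simpa [Fin.forall_fin_two] using hkA
  · ext x
    simp [Fin.exists_fin_two]

theorem le_label_of_schreier (ha : IsLimitChoice a) {𝒢 : Set (Finset ℕ)} {φ : List ℕ → Ordinal.{0}}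
    (hφ : ∀ x k, x ++ [k] ∈ injectiveTuples 𝒢 → φ (x ++ [k]) < φ x) {α : Ordinal.{0}} (hα : α < ω₁)
    {x : List ℕ} (hx : x.Nodup) {N : ℕ} (hxN : ∀ i ∈ x, i < N)
    (hx𝒢 : ∀ A, Schreier a α A → (∀ i ∈ A, N ≤ i) → ∃ G ∈ 𝒢, x.toFinset ∪ A ⊆ G) : α ≤ φ x := by
  induction α using Ordinal.limitRecOn generalizing x N with
  | zero => exact zero_le
  | add_one α ih =>
    have hα' : α < ω₁ := (lt_add_one α).trans hα
    have hnodup : (x ++ [N + 2]).Nodup := by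
      refine hx.append (List.nodup_singleton _) (List.disjoint_singleton.2 fun h => ?_)
      have := hxN _ h
      omega
    have hmem : x ++ [N + 2] ∈ injectiveTuples 𝒢 := by
      obtain ⟨G, hG, hxG⟩ := hx𝒢 {N + 2} (schreier_singleton ha (by omega) hα) (by simp)
      exact ⟨hnodup, G, hG, fun i hi => hxG (by simpa [or_comm] using hi)⟩
    refine Order.add_one_le_of_lt ((ih hα' hnodup (N := N + 3) ?_ fun A hA hNA => ?_).trans_lt
      (hφ _ _ hmem))
    · intro i hi
      rcases List.mem_append.1 hi with hi | hi
      · exact (hxN i hi).trans (by omega)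
      · simp_all
    · obtain ⟨G, hG, hxG⟩ := hx𝒢 (insert (N + 2) A)
        (schreier_insert ha (by omega) hα' hA hNA)
        (by simpa using fun i hi => (Nat.le_add_right N 3).trans (hNA i hi))
      refine ⟨G, hG, ?_⟩
      simpa only [List.toFinset_append, List.toFinset_cons, List.toFinset_nil, insert_empty_eq,
        Finset.union_assoc, Finset.insert_eq] using hxG
  | limit β hβ ih =>
    obtain ⟨hmono, hlt, hlub⟩ := ha β hα hβ
    refine (isLUB_le_iff hlub).2 ?_
    rintro _ ⟨n, rfl⟩
    -- The term of index `0` plays no role in `S_β`, hence the shift to index `n + 1`.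
    refine (hmono n.le_succ).trans (ih _ (hlt _) ((hlt _).trans hα) hx (N := max N (n + 1))
      (fun i hi => lt_max_of_lt_left (hxN i hi)) fun A hA hNA => ?_)
    exact hx𝒢 A
      (.limit β hβ (n + 1) (by omega) A (fun i hi => (le_max_right _ _).trans (hNA i hi)) hA)
      fun i hi => (le_max_left _ _).trans (hNA i hi)

theorem rankGE_schreier (ha : IsLimitChoice a) {α : Ordinal.{0}} (hα : α < ω₁) :
    RankGE (injectiveTuples {A | Schreier a α A}) α := fun _ hφ =>
  le_label_of_schreier ha hφ hα List.nodup_nil (N := 0) (by simp) fun A hA _ => ⟨A, hA, by simp⟩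

end SchreierRank

/-! ### Coarse embeddings of `c₀` -/

/-- The vector `∑ i, x i • e (u i)`, for a vector `x` supported in `{0, …, u.length - 1}`; entries
of `x` outside this range are sent to the junk position `0`. -/
noncomputable def transportAlong (u : List ℕ) (x : ℕ →₀ ℤ) : ℕ →₀ ℤ :=
  x.mapDomain fun i => u.getD i 0

theorem transportAlong_take {u : List ℕ} {n : ℕ} {x : ℕ →₀ ℤ} (hx : x.support ⊆ Finset.range n) :
    transportAlong (u.take n) x = transportAlong u x :=
  Finsupp.mapDomain_congr fun i hi => by
    simp [List.getD_eq_getElem?_getD, List.getElem?_take_of_lt (Finset.mem_range.1 (hx hi))]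

theorem toC₀_transportAlong_mem_supportedIn {𝒢 : Set (Finset ℕ)} {u : List ℕ}
    (hu : u ∈ injectiveTuples 𝒢) {x : ℕ →₀ ℤ} (hx : x.support ⊆ Finset.range u.length) :
    toC₀ (transportAlong u x) ∈ supportedIn 𝒢 (Set.range ((↑) : ℤ → ℝ)) := by
  obtain ⟨-, G, hG, huG⟩ := mem_injectiveTuples.1 hu
  refine toC₀_mapDomain_mem_supportedIn hG fun i hi => ?_
  rw [List.getD_eq_getElem _ _ (Finset.mem_range.1 (hx hi))]
  exact huG _ (List.getElem_mem _)

theorem dist_toC₀_transportAlong {u : List ℕ} (hu : u.Nodup) {x y : ℕ →₀ ℤ}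
    (hx : x.support ⊆ Finset.range u.length) (hy : y.support ⊆ Finset.range u.length) :
    dist (toC₀ (transportAlong u x)) (toC₀ (transportAlong u y)) = dist (toC₀ x) (toC₀ y) := by
  refine dist_toC₀_mapDomain (fun i hi j hj hij => ?_) hx hy
  have hi : i < u.length := by simpa using hi
  have hj : j < u.length := by simpa using hj
  exact hu.getElem_inj_iff.1 (by simpa only [List.getD_eq_getElem, hi, hj] using hij)

theorem exists_surjective_forall_of_eventually {X : Type*} [Countable X] {p : ℕ → X → Prop} {x₀ : X}
    (hx₀ : ∀ n, p n x₀) (hp : ∀ x, ∀ᶠ n in atTop, p n x) :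
    ∃ e : ℕ → X, Function.Surjective e ∧ ∀ n, p n (e n) := by
  classical
  have : Nonempty X := ⟨x₀⟩
  obtain ⟨g, hg⟩ := exists_surjective_nat X
  -- Every element is proposed infinitely often, so once at a late enough index.
  refine ⟨fun n => if p n (g n.unpair.1) then g n.unpair.1 else x₀, fun x => ?_, fun n => ?_⟩
  · obtain ⟨k, rfl⟩ := hg x
    obtain ⟨n₀, hn₀⟩ := eventually_atTop.1 (hp (g k))
    exact ⟨Nat.pair k n₀, by simp [hn₀ _ (Nat.right_le_pair k n₀)]⟩
  · dsimp only
    split_ifs with h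
    exacts [h, hx₀ n]

theorem exists_surjective_support_subset_range :
    ∃ e : ℕ → ℕ →₀ ℤ, Function.Surjective e ∧ ∀ n, (e n).support ⊆ Finset.range n :=
  exists_surjective_forall_of_eventually (p := fun n (x : ℕ →₀ ℤ) => x.support ⊆ Finset.range n)
    (x₀ := 0) (by simp) fun x => tendsto_finset_range.eventually_ge_atTop x.support

theorem coarselyEmbeds_c₀_of_rankGE {M : Type*} [MetricSpace M] [TopologicalSpace.SeparableSpace M]
    [Nonempty M] {ι : Type*} {𝒢 : ι → Set (Finset ℕ)}
    (h𝒢 : ∀ β < ω₁, ∃ i, RankGE (injectiveTuples (𝒢 i)) β)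
    (hM : ∀ i, CoarselyEmbeds (supportedIn (𝒢 i) (Set.range ((↑) : ℤ → ℝ))) M) :
    CoarselyEmbeds C₀(ℕ, ℝ) M := by
  choose S R Φ hΦ using fun i => (hM i).exists_controlled_denseSeq
  obtain ⟨e, hesurj, he⟩ := exists_surjective_support_subset_range
  choose code hcode using hesurj
  obtain ⟨w, hw⟩ := exists_colour_branch h𝒢 fun i u =>
    (Φ i (toC₀ (transportAlong u (e u.length))), S i u.length, R i u.length)
  refine .of_controlled_net (S := fun k => (w k).2.1) (R := fun k => (w k).2.2) toC₀
    (fun x => TopologicalSpace.denseSeq M (w (code x)).1) (fun x y => .of_forall_eq_lt fun n => ?_)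
    (c := 1) fun f => (exists_dist_toC₀_le_half f).imp fun x hx => hx.trans (by norm_num)
  set N := max n (max (code x) (code y) + 1)
  obtain ⟨i, u, hu, hlength, hcolour⟩ := hw N
  have hsupport {z : ℕ →₀ ℤ} (hz : code z < N) : z.support ⊆ Finset.range u.length := by
    rw [hlength, ← hcode z]
    exact (he _).trans (Finset.range_mono hz.le)
  have hcolour_eq (k : ℕ) (hk : k < N) :
      (Φ i (toC₀ (transportAlong u (e k))), S i k, R i k) = w k := by
    rw [← hcolour k hk, List.length_take_of_le (hlength ▸ hk.le), transportAlong_take (he k)]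
  have hpoint {z : ℕ →₀ ℤ} (hz : code z < N) :
      Φ i (toC₀ (transportAlong u z)) = (w (code z)).1 := by
    rw [← hcolour_eq _ hz, hcode]
  have hx : code x < N := lt_max_of_lt_right (Nat.lt_succ_of_le (le_max_left _ _))
  have hy : code y < N := lt_max_of_lt_right (Nat.lt_succ_of_le (le_max_right _ _))
  refine ⟨S i, R i, fun k hk => ?_, ?_⟩
  · rw [← hcolour_eq k (hk.trans_le (le_max_left _ _))]
    exact ⟨rfl, rfl⟩
  · rw [← hpoint hx, ← hpoint hy,
      ← dist_toC₀_transportAlong (mem_injectiveTuples.1 hu).1 (hsupport hx) (hsupport hy)]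
    exact hΦ i _ (toC₀_transportAlong_mem_supportedIn hu (hsupport hx)) _
      (toC₀_transportAlong_mem_supportedIn hu (hsupport hy))

theorem mainTheorem8_general {M : Type*} [MetricSpace M] [TopologicalSpace.SeparableSpace M]
    (a : Ordinal.{0} → ℕ → Ordinal.{0}) (ha : IsLimitChoice a)
    (hM : ∀ α : Ordinal.{0}, α < ω₁ → CoarselyEmbeds (schreierSpace a α) M) :
    CoarselyEmbeds C₀(ℕ, ℝ) M := by
  have hne : Nonempty (schreierSpace a 0) :=
    ⟨0, {1}, .zero 1 le_rfl, fun i _ => ⟨0, by simp⟩, fun i _ => rfl⟩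
  have : Nonempty M := (hM 0 (Ordinal.omega_pos 1)).nonempty
  exact coarselyEmbeds_c₀_of_rankGE (ι := Set.Iio ω₁) (𝒢 := fun α => {A | Schreier a α A})
    (fun α hα => ⟨⟨α, hα⟩, rankGE_schreier ha hα⟩) fun α => hM α α.2

/-- `Fin 4 → M` is `M⁴` with the maximum metric. -/
theorem mainTheorem8 {M : Type*} [MetricSpace M] [TopologicalSpace.SeparableSpace M]
    (a : Ordinal.{0} → ℕ → Ordinal.{0}) (ha : IsLimitChoice a)
    (hM : ∀ α : Ordinal.{0}, α < ω₁ → CoarselyEmbeds (schreierSpace a α) M) :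
    CoarselyEmbeds C₀(ℕ, ℝ) (Fin 4 → M) :=
  (mainTheorem8_general a ha hM).pi_const
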